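/- \textbf{Setting.} A \emph{partition} $\pi$ is a sequence $0=t_0<t_1<\dots$ in $[0,\infty]$ without accumulation points in $[0,\infty)$, possibly taking the value $\infty$ (after which it stays at $\infty$). For a continuous $S\colon[0,\infty)\to\mathbb R$ and $t\ge 0$ put $m(S,\pi[0,t]):=\max_j|S(t_{j+1}\wedge t)-S(t_j\wedge t)|$ and define the discrete local time $$L^\pi_t(u):=\sum_{t_j\in\pi}\mathbf 1_{(\!(S(t_j\wedge t),\,S(t_{j+1}\wedge t)]\!]}(u)\,|S(t_{j+1}\wedge t)-u|,\qquad u\in\mathbb R,$$ where $(\!(a,b]\!]$ denotes $(a,b]$ if $a\le b$ and $(b,a]$ if $a>b$. For $p\ge1$, $g\colon\mathbb R\to\mathbb R$ and $A\subseteq\mathbb R$ let $\|g\|_{p\text{-var},A}:=\sup\big(\sum_{k=1}^n|g(u_k)-g(u_{k-1})|^p\big)^{1/p}$, the supremum being over all $n$ and all $u_0<\dots<u_n$ in $A$; write $\|g\|_{p\text{-var}}$ if $A=\mathbb R$. The function $g$ has locally finite $p$-variation if $\|g\|_{p\text{-var},[a,b]}<\infty$ for all $a<b$. Let $\mathcal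 V^p$ be the space of right-continuous $g\colon\mathbb R\to\mathbb R$ with $\|g\|_{p\text{-var}}<\infty$, with norm $\max\{\|g\|_{p\text{-var}},\|g\|_\infty\}$. For a sequence of partitions $(\pi^n)$, let $\mathcal L_{c,p}(\pi^n)$ be the set of continuous $S\colon[0,\infty)\to\mathbb R$ such that: (i) for every $t\ge0$, $m(S,\pi^n[0,t])\to0$ and $L^{\pi^n}_t$ converges weakly in $L^2(\mathrm du)$; (ii) for every $t\ge0$, $L^{\pi^n}_t$ converges uniformly on $\mathbb R$ to a limit $L_t$, and $(t,u)\mapsto L_t(u)$ is jointly continuous; (iii) $\sup_n\sup_{t\in[0,T]}\|L^{\pi^n}_t\|_{p\text{-var}}<\infty$ for every $T>0$. \textbf{Theorem.} Let $p,q\ge1$ with $\frac1p+\frac1q>1$, let $(\pi^n)$ be a sequence of partitions and let $S\in\mathcal L_{c,p}(\pi^n)$, with continuous local time $L$. (a) Let $f\colon\mathbb R\to\mathbb R$ be absolutely continuous on compact intervals, with a right-continuous Radon--Nikodym derivative $f'$ of locally finite $q$-variation. Then for all $t\in[0,\infty)$ $$f(S(t))=f(S(0))+\int_0^tf'(S(s))\,\mathrm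 dS(s)+\int_{-\infty}^\infty L_t(u)\,\mathrm df'(u),$$ where the limit $$\int_0^tf'(S(s))\,\mathrm dS(s):=\lim_{n\to\infty}\sum_{t_j\in\pi^n}f'(S(t_j))\big(S(t_{j+1}\wedge t)-S(t_j\wedge t)\big)$$ exists, and where $\int_{-\infty}^\infty L_t\,\mathrm df'$ is a Young integral: for all $a\le b$ the Riemann sums $\sum_iL_t(u_i)(f'(u_{i+1})-f'(u_i))$ over partitions of $[a,b]$ converge as the mesh size goes to zero, and their limits converge as $a\to-\infty$, $b\to\infty$. (b) In particular, $\int_0^tg(S(s))\,\mathrm dS(s)$ exists as the limit of the Riemann sums along $(\pi^n)$ for every right-continuous $g$ of locally finite $q$-variation and all $t\ge0$, and for every $T>0$ the map $\mathcal V^q\ni g\mapsto\int_0^\cdot g(S(s))\,\mathrm dS(s)\in C([0,T],\mathbb R)$ is a bounded linear operator. -/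

import Mathlib

open scoped NNReal ENNReal Topology
open Filter MeasureTheory

noncomputable section

/-- A partition `0 = t₀ < t₁ < …` of `[0, ∞)` without accumulation points. The points may take the
value `∞`, and once a point is `∞` all later ones are, which encodes finite partitions. -/
structure TimePartition where
  pt : ℕ → ℝ≥0∞
  pt_zero : pt 0 = 0
  mono : Monotone pt
  lt_succ : ∀ j, pt j ≠ ∞ → pt j < pt (j + 1)
  tendsto_top : Tendsto pt atTop (𝓝 ∞)

/-- The stopped partition point `t_j ∧ t`. -/
def TimePartition.stopped (π : TimePartition) (j : ℕ) (t : ℝ≥0) : ℝ≥0 :=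
  (min (π.pt j) (t : ℝ≥0∞)).toNNReal

/-- The mesh size `m(S, π[0,T])` of `π` along `S`: the largest increment of `S` between consecutive
points of `π` stopped at `T` (only finitely many of them are nonzero). -/
def meshAlong (S : ℝ≥0 → ℝ) (π : TimePartition) (T : ℝ≥0) : ℝ :=
  ⨆ j : ℕ, |S (π.stopped (j + 1) T) - S (π.stopped j T)|

/-- The discrete local time
`L^π_t(S,u) = ∑_j 1_{⦅S(t_j ∧ t), S(t_{j+1} ∧ t)⟧}(u) |S(t_{j+1} ∧ t) - u|`. All but finitely many
summands vanish; `Set.uIoc a b` is `(a,b]` if `a ≤ b` and `(b,a]` otherwise. -/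
def discreteLocalTime (S : ℝ≥0 → ℝ) (π : TimePartition) (t : ℝ≥0) (u : ℝ) : ℝ :=
  ∑' j : ℕ, (Set.uIoc (S (π.stopped j t)) (S (π.stopped (j + 1) t))).indicator
    (fun v => |S (π.stopped (j + 1) t) - v|) u

/-- The Riemann sum `∑_j g(S(t_j)) (S(t_{j+1} ∧ t) - S(t_j ∧ t))` along `π`. All but finitely many
summands vanish, in particular those with `t_j = ∞`. -/
def riemannSum (S : ℝ≥0 → ℝ) (π : TimePartition) (g : ℝ → ℝ) (t : ℝ≥0) : ℝ :=
  ∑' j : ℕ, g (S (π.pt j).toNNReal) * (S (π.stopped (j + 1) t) - S (π.stopped j t))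

/-- `I` is the pathwise integral `∫₀ᵗ g(S(s)) dS(s)` along `(πⁿ)`: the limit of Riemann sums. -/
def HasPathwiseIntegral (S : ℝ≥0 → ℝ) (π : ℕ → TimePartition) (g : ℝ → ℝ) (t : ℝ≥0) (I : ℝ) :
    Prop :=
  Tendsto (fun n => riemannSum S (π n) g t) atTop (𝓝 I)

/-- Weak convergence in `L²(ℝ, du)`. -/
def TendstoWeaklyL2 (φ : ℕ → ℝ → ℝ) (ψ : ℝ → ℝ) : Prop :=
  (∀ n, MemLp (φ n) 2 volume) ∧ MemLp ψ 2 volume ∧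
    ∀ h : ℝ → ℝ, MemLp h 2 volume →
      Tendsto (fun n => ∫ u, φ n u * h u) atTop (𝓝 (∫ u, ψ u * h u))

/-- `L` is an `L²`-local time of `S` along `(πⁿ)`. -/
def IsL2LocalTime (S : ℝ≥0 → ℝ) (π : ℕ → TimePartition) (L : ℝ≥0 → ℝ → ℝ) : Prop :=
  ∀ t : ℝ≥0, Tendsto (fun n => meshAlong S (π n) t) atTop (𝓝 0) ∧
    TendstoWeaklyL2 (fun n => discreteLocalTime S (π n) t) (L t)

/-- The continuous paths having an `L²`-local time along `(πⁿ)`. -/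
def l2LocalTimePaths (π : ℕ → TimePartition) : Set (ℝ≥0 → ℝ) :=
  {S | Continuous S ∧ ∃ L, IsL2LocalTime S π L}

/-- `L` is the continuous local time of `S` along `(πⁿ)`. -/
def IsContinuousLocalTime (S : ℝ≥0 → ℝ) (π : ℕ → TimePartition) (L : ℝ≥0 → ℝ → ℝ) : Prop :=
  S ∈ l2LocalTimePaths π ∧
    (∀ t : ℝ≥0, TendstoUniformly (fun n => discreteLocalTime S (π n) t) (L t) atTop) ∧
    Continuous (fun x : ℝ≥0 × ℝ => L x.1 x.2)

/-- The `p`-variation `sup (∑ |f(u_{k+1}) - f(u_k)|^p)^{1/p}` of `f` on `s`, over finite increasing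
families of points of `s` (repeated points contribute nothing, as `p > 0` in all uses). -/
def pVariationOn (p : ℝ) (f : ℝ → ℝ) (s : Set ℝ) : ℝ≥0∞ :=
  ⨆ x : ℕ × {u : ℕ → ℝ // Monotone u ∧ ∀ i, u i ∈ s},
    (∑ k ∈ Finset.range x.1, edist (f (x.2.1 (k + 1))) (f (x.2.1 k)) ^ p) ^ (1 / p)

/-- The set `𝓛_{c,p}(πⁿ)` of paths with a continuous local time along `(πⁿ)` whose discrete local
times have bounded `p`-variation, uniformly in `n` and in `t ∈ [0,T]`, for every `T`. -/
def localTimePaths (p : ℝ) (π : ℕ → TimePartition) : Set (ℝ≥0 → ℝ) :=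
  {S | (∃ L, IsContinuousLocalTime S π L) ∧
    ∀ T : ℝ≥0, 0 < T →
      (⨆ n : ℕ, ⨆ t ∈ Set.Icc 0 T,
        pVariationOn p (discreteLocalTime S (π n) t) Set.univ) < ∞}

def RightContinuous (g : ℝ → ℝ) : Prop :=
  ∀ x, ContinuousWithinAt g (Set.Ici x) x

def LocallyFinitePVariation (q : ℝ) (g : ℝ → ℝ) : Prop :=
  ∀ a b : ℝ, pVariationOn q g (Set.Icc a b) < ∞

/-- `f` is absolutely continuous (on compact intervals) with Radon-Nikodym derivative `f'`. -/
def IsAbsolutelyContinuousWithDeriv (f f' : ℝ → ℝ) : Prop :=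
  (∀ a b : ℝ, AbsolutelyContinuousOnInterval f a b) ∧ ∀ᵐ x, HasDerivAt f (f' x) x

/-- `I` is the Young integral `∫_a^b φ dg`: the Riemann sums `∑ φ(u_i) (g(u_{i+1}) - g(u_i))` over
partitions of `[a,b]` converge to `I` as the mesh size of the partition goes to zero. -/
def HasYoungIntegralOn (φ g : ℝ → ℝ) (a b : ℝ) (I : ℝ) : Prop :=
  ∀ ε > 0, ∃ δ > 0, ∀ (n : ℕ) (u : ℕ → ℝ), Monotone u → u 0 = a → u n = b →
    (∀ i < n, u (i + 1) - u i < δ) →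
      |∑ i ∈ Finset.range n, φ (u i) * (g (u (i + 1)) - g (u i)) - I| < ε

/-- `I` is the Young integral `∫_{-∞}^∞ φ dg`: the Young integrals over all compact intervals
`[a,b]` exist and converge to `I` as `a → -∞` and `b → ∞`. -/
def HasYoungIntegral (φ g : ℝ → ℝ) (I : ℝ) : Prop :=
  ∃ J : ℝ → ℝ → ℝ, (∀ a b : ℝ, a ≤ b → HasYoungIntegralOn φ g a b (J a b)) ∧
    Tendsto (fun x : ℝ × ℝ => J x.1 x.2) (atBot ×ˢ atTop) (𝓝 I)

theorem pVariationOn_add_le {p : ℝ} (hp : 1 ≤ p) (f g : ℝ → ℝ) (s : Set ℝ) :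
    pVariationOn p (f + g) s ≤ pVariationOn p f s + pVariationOn p g s := by
  refine iSup_le fun x => ?_
  refine le_trans ?_ (add_le_add
    (le_iSup (fun x : ℕ × {u : ℕ → ℝ // Monotone u ∧ ∀ i, u i ∈ s} =>
      (∑ k ∈ Finset.range x.1, edist (f (x.2.1 (k + 1))) (f (x.2.1 k)) ^ p) ^ (1 / p)) x)
    (le_iSup (fun x : ℕ × {u : ℕ → ℝ // Monotone u ∧ ∀ i, u i ∈ s} =>
      (∑ k ∈ Finset.range x.1, edist (g (x.2.1 (k + 1))) (g (x.2.1 k)) ^ p) ^ (1 / p)) x))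
  refine le_trans ?_ (ENNReal.Lp_add_le _ _ _ hp)
  gcongr with k hk
  exact edist_add_add_le _ _ _ _

theorem pVariationOn_smul_le {p : ℝ} (hp : 1 ≤ p) (c : ℝ) (f : ℝ → ℝ) (s : Set ℝ) :
    pVariationOn p (c • f) s ≤ ‖c‖ₑ * pVariationOn p f s := by
  have hp0 : 0 < p := by linarith
  refine iSup_le fun x => ?_
  refine le_trans (le_of_eq ?_) (mul_le_mul_right
    (le_iSup (fun x : ℕ × {u : ℕ → ℝ // Monotone u ∧ ∀ i, u i ∈ s} =>
      (∑ k ∈ Finset.range x.1, edist (f (x.2.1 (k + 1))) (f (x.2.1 k)) ^ p) ^ (1 / p)) x) _)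
  have h : ∀ a b : ℝ, edist (c * a) (c * b) ^ p = ‖c‖ₑ ^ p * edist a b ^ p := fun a b => by
    rw [edist_eq_enorm_sub, edist_eq_enorm_sub, ← mul_sub, enorm_mul,
      ENNReal.mul_rpow_of_nonneg _ _ hp0.le]
  simp only [Pi.smul_apply, smul_eq_mul, h]
  rw [← Finset.mul_sum, ENNReal.mul_rpow_of_nonneg _ _ (by positivity), ← ENNReal.rpow_mul,
    mul_one_div_cancel hp0.ne', ENNReal.rpow_one]

/-- The space `𝒱^q` of right-continuous functions of finite `q`-variation on `ℝ`. -/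
def pVarSpace (q : ℝ) (hq : 1 ≤ q) : Submodule ℝ (ℝ → ℝ) where
  carrier := {g | RightContinuous g ∧ pVariationOn q g Set.univ < ∞}
  zero_mem' := by
    refine ⟨fun x => continuousWithinAt_const, ?_⟩
    have h := pVariationOn_smul_le hq 0 0 Set.univ
    simp only [smul_zero, enorm_zero, zero_mul] at h
    exact h.trans_lt ENNReal.zero_lt_top
  add_mem' := fun {f g} hf hg =>
    ⟨fun x => (hf.1 x).add (hg.1 x),
      (pVariationOn_add_le hq f g _).trans_lt (ENNReal.add_lt_top.2 ⟨hf.2, hg.2⟩)⟩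
  smul_mem' := fun c f hf =>
    ⟨fun x => (hf.1 x).const_smul c,
      (pVariationOn_smul_le hq c f _).trans_lt (ENNReal.mul_lt_top enorm_lt_top hf.2)⟩

/-- The norm of `𝒱^q`: the maximum of the `q`-variation seminorm and the supremum norm. -/
def pVarNorm (q : ℝ) (g : ℝ → ℝ) : ℝ :=
  max (pVariationOn q g Set.univ).toReal (⨆ x : ℝ, |g x|)

end

/-! For one step from `c` to `d`, writing the kernel `1_{⦅c,d⟧}(e) |d - e|` as the oriented integral
over `x` from `c` to `d` of `1_{e ≤ x} - 1_{e ≤ c}` and exchanging it with integration against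
`dg(e)` gives `∫_c^d (g(x) - g(c)) dx`. Summing over the steps of a partition yields the discrete
Tanaka-Meyer formula: the integral of `g` from `S 0` to `S t` minus the Riemann sum of `g(S)` equals
`∫ L^π_t dg` (`tendsto_stieltjesSum_discreteLocalTime`). Here `∫ L^π_t dg` means the limit of
left-point sums along uniform grids of an interval containing the path; right-continuity of `g`
suffices for this limit.

It remains to pass to the limit in `∫ L^{πⁿ}_t dg`. The Love-Young estimate controls
Riemann-Stieltjes sums over every partition, with no continuity assumption. Interpolating
`p`-variation with the supremum norm gives small `r`-variation for some `r > p` still satisfying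
`1/r + 1/q > 1`. So sums of a uniformly small function of bounded `p`-variation are small, uniformly
over partitions (`exists_abs_stieltjesSum_lt`). This is used three times: for `L^{πⁿ}_t - L_t`
(convergence of the Riemann sums), for the difference between `L_t` and a step version of it
(existence of the Young integral), and for `L_s - L_t` (continuity in time).

For `g = f'` the integral of `g` is `f(S t) - f(S 0)`, which is the change of variables formula. The
operator bound is the Love-Young estimate for `L_t`, whose boundary term vanishes. -/

/-! ### Love-Young estimate for finite sums. -/

/-- The Riemann-Stieltjes sum `∑_{i<n} φ(u_i) (g(u_{i+1}) - g(u_i))`. -/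
def stieltjesSum (φ g : ℝ → ℝ) (u : ℕ → ℝ) (n : ℕ) : ℝ :=
  ∑ i ∈ Finset.range n, φ (u i) * (g (u (i + 1)) - g (u i))

/-- The `p`-variation of `f` on `s` is at most `A`. -/
def HasPVarBound (p : ℝ) (f : ℝ → ℝ) (s : Set ℝ) (A : ℝ) : Prop :=
  ∀ (n : ℕ) (u : ℕ → ℝ), Monotone u → (∀ i ≤ n, u i ∈ s) →
    ∑ k ∈ Finset.range n, |f (u (k + 1)) - f (u k)| ^ p ≤ A ^ p

/-- With `θ = 1/p + 1/q` the exponents `pθ` and `qθ` are conjugate. Hölder applied to `a ^ (1/θ)`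
and `b ^ (1/θ)` bounds the sum of `(a b) ^ (1/θ)` by `(A B) ^ (1/θ)`, and some term is at most the
average. -/
theorem exists_mul_le_of_sum_rpow_le {p q : ℝ} (hp : 0 < p) (hq : 0 < q) {a b : ℕ → ℝ}
    (ha : ∀ k, 0 ≤ a k) (hb : ∀ k, 0 ≤ b k) {A B : ℝ} (hA : 0 ≤ A) (hB : 0 ≤ B) {n : ℕ}
    (hn : n ≠ 0) (hsa : ∑ k ∈ Finset.range n, a k ^ p ≤ A ^ p)
    (hsb : ∑ k ∈ Finset.range n, b k ^ q ≤ B ^ q) :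
    ∃ k < n, a k * b k ≤ A * B * ((n : ℝ) ^ (1 / p + 1 / q))⁻¹ := by
  set θ := 1 / p + 1 / q with hθ
  have hθ0 : 0 < θ := by positivity
  have hconj : (p * θ).HolderConjugate (q * θ) := by
    rw [Real.holderConjugate_iff]
    have h1 : p * θ = 1 + p / q := by rw [hθ]; field_simp
    have h2 : q * θ = 1 + q / p := by rw [hθ]; field_simp; ring
    refine ⟨by rw [h1]; linarith [div_pos hp hq], ?_⟩
    rw [h1, h2]; field_simp; ring
  have hn' : (0 : ℝ) < n := by exact_mod_cast Nat.pos_of_ne_zero hn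
  have key : ∀ {r x : ℝ}, 0 < r → 0 ≤ x → (x ^ (1 / θ)) ^ (r * θ) = x ^ r := fun {r x} hr hx => by
    rw [← Real.rpow_mul hx]; congr 1; field_simp
  have key2 : ∀ {r x y : ℝ}, 0 < r → 0 ≤ x → 0 ≤ y → y ≤ x ^ r →
      y ^ (1 / (r * θ)) ≤ x ^ (1 / θ) := fun {r x y} hr hx hy h => by
    calc y ^ (1 / (r * θ)) ≤ (x ^ r) ^ (1 / (r * θ)) := by gcongr
      _ = x ^ (1 / θ) := by rw [← Real.rpow_mul hx]; congr 1; field_simp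
  have hH := Real.inner_le_Lp_mul_Lq_of_nonneg (Finset.range n) (f := fun k => a k ^ (1 / θ))
    (g := fun k => b k ^ (1 / θ)) hconj (fun k _ => by have := ha k; positivity)
    (fun k _ => by have := hb k; positivity)
  simp only [key hp (ha _), key hq (hb _)] at hH
  have h1 := key2 hp hA (Finset.sum_nonneg fun k _ => by have := ha k; positivity) hsa
  have h2 := key2 hq hB (Finset.sum_nonneg fun k _ => by have := hb k; positivity) hsb
  have h3 : ∑ k ∈ Finset.range n, a k ^ (1 / θ) * b k ^ (1 / θ) ≤
      ∑ _k ∈ Finset.range n, (A * B) ^ (1 / θ) * (n : ℝ)⁻¹ := by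
    rw [Finset.sum_const, Finset.card_range, nsmul_eq_mul, Real.mul_rpow hA hB]
    refine hH.trans ((mul_le_mul h1 h2
      (Real.rpow_nonneg (Finset.sum_nonneg fun k _ => Real.rpow_nonneg (hb k) _) _)
      (by positivity)).trans (le_of_eq ?_))
    field_simp
  obtain ⟨k, hk, hle⟩ := Finset.exists_le_of_sum_le (Finset.nonempty_range_iff.2 hn) h3
  refine ⟨k, Finset.mem_range.1 hk, ?_⟩
  rw [← Real.mul_rpow (ha k) (hb k)] at hle
  have h4 := Real.rpow_le_rpow (Real.rpow_nonneg (mul_nonneg (ha k) (hb k)) _) hle hθ0.le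
  rw [Real.mul_rpow (Real.rpow_nonneg (mul_nonneg hA hB) _) (inv_nonneg.2 hn'.le),
    ← Real.rpow_mul (mul_nonneg (ha k) (hb k)), ← Real.rpow_mul (mul_nonneg hA hB),
    one_div_mul_cancel hθ0.ne', Real.rpow_one, Real.rpow_one,
    Real.inv_rpow hn'.le] at h4
  exact h4

theorem stieltjesSum_sub_remove (φ g : ℝ → ℝ) (u : ℕ → ℝ) (j m : ℕ) :
    stieltjesSum φ g u (j + 1 + m + 1) -
      stieltjesSum φ g (fun k => if k ≤ j then u k else u (k + 1)) (j + 1 + m) =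
      (φ (u (j + 1)) - φ (u j)) * (g (u (j + 2)) - g (u (j + 1))) := by
  induction m with
  | zero =>
    simp only [stieltjesSum, add_zero]
    rw [Finset.sum_range_succ, Finset.sum_range_succ, Finset.sum_range_succ]
    have : ∑ i ∈ Finset.range j, φ (if i ≤ j then u i else u (i + 1)) *
        (g (if i + 1 ≤ j then u (i + 1) else u (i + 1 + 1)) - g (if i ≤ j then u i else u (i + 1)))
        = ∑ i ∈ Finset.range j, φ (u i) * (g (u (i + 1)) - g (u i)) := by
      refine Finset.sum_congr rfl fun i hi => ?_
      have := Finset.mem_range.1 hi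
      rw [if_pos (by omega), if_pos (by omega)]
    rw [this, if_pos le_rfl, if_neg (by omega)]
    ring
  | succ m ih =>
    rw [← ih]
    simp only [stieltjesSum]
    rw [Finset.sum_range_succ _ (j + 1 + (m + 1)), ← add_assoc (j + 1) m 1,
      Finset.sum_range_succ _ (j + 1 + m)]
    rw [Finset.sum_range_succ _ (j + 1 + m), if_neg (by omega), if_neg (by omega)]
    ring

/-- **Love-Young estimate** for Riemann-Stieltjes sums. -/
theorem abs_stieltjesSum_sub_le_sum {p q : ℝ} (hp : 0 < p) (hq : 0 < q) {φ g : ℝ → ℝ} {s : Set ℝ}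
    {A B : ℝ} (hA : 0 ≤ A) (hB : 0 ≤ B) (hφ : HasPVarBound p φ s A) (hg : HasPVarBound q g s B)
    (n : ℕ) (u : ℕ → ℝ) (hu : Monotone u) (hus : ∀ i ≤ n, u i ∈ s) :
    |stieltjesSum φ g u n - φ (u 0) * (g (u n) - g (u 0))| ≤
      A * B * ∑ k ∈ Finset.range n, ((k : ℝ) ^ (1 / p + 1 / q))⁻¹ := by
  induction n generalizing u with
  | zero => simp [stieltjesSum]
  | succ n ih =>
    rcases Nat.eq_zero_or_pos n with rfl | hn
    · simp only [stieltjesSum, zero_add, Finset.range_one, Finset.sum_singleton, sub_self, abs_zero]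
      positivity
    -- Among the `n` interior points, `u (j + 1)` is the cheapest to delete: the increment of `φ` to
    -- its left times that of `g` to its right is at most the term `k = n` of the bound.
    obtain ⟨j, hj, hle⟩ := exists_mul_le_of_sum_rpow_le hp hq
      (a := fun k => |φ (u (k + 1)) - φ (u k)|) (b := fun k => |g (u (k + 2)) - g (u (k + 1))|)
      (fun _ => abs_nonneg _) (fun _ => abs_nonneg _) hA hB hn.ne'
      (hφ n u hu fun i hi => hus i (by omega))
      (hg n (fun k => u (k + 1)) (fun a b hab => hu (by omega)) fun i hi => hus _ (by omega))
    obtain ⟨m, rfl⟩ : ∃ m, n = j + 1 + m := ⟨n - (j + 1), by omega⟩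
    have hrem := stieltjesSum_sub_remove φ g u j m
    set v : ℕ → ℝ := fun k => if k ≤ j then u k else u (k + 1) with hv
    have hvm : Monotone v := by
      intro a b hab
      simp only [hv]
      split_ifs <;> exact hu (by omega)
    have hvs : ∀ i ≤ j + 1 + m, v i ∈ s := by
      intro i hi
      simp only [hv]
      split_ifs <;> exact hus _ (by omega)
    have h0 : v 0 = u 0 := by simp [hv]
    have h1 : v (j + 1 + m) = u (j + 1 + m + 1) := by
      simp only [hv]; rw [if_neg (by omega)]
    have hi := ih v hvm hvs
    rw [h0, h1] at hi
    rw [Finset.sum_range_succ, mul_add]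
    have : stieltjesSum φ g u (j + 1 + m + 1) - φ (u 0) * (g (u (j + 1 + m + 1)) - g (u 0)) =
        (stieltjesSum φ g v (j + 1 + m) - φ (u 0) * (g (u (j + 1 + m + 1)) - g (u 0))) +
        (φ (u (j + 1)) - φ (u j)) * (g (u (j + 2)) - g (u (j + 1))) := by
      rw [← hrem]; ring
    rw [this]
    refine (abs_add_le _ _).trans (add_le_add hi ?_)
    rw [abs_mul]
    exact hle

/-- The constant of the Love-Young estimate. -/
noncomputable def youngConst (p q : ℝ) : ℝ := ∑' k : ℕ, ((k : ℝ) ^ (1 / p + 1 / q))⁻¹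

theorem youngConst_nonneg (p q : ℝ) : 0 ≤ youngConst p q :=
  tsum_nonneg fun _ => by positivity

theorem abs_stieltjesSum_sub_le {p q : ℝ} (hp : 0 < p) (hq : 0 < q) (hpq : 1 < 1 / p + 1 / q)
    {φ g : ℝ → ℝ} {s : Set ℝ} {A B : ℝ} (hA : 0 ≤ A) (hB : 0 ≤ B) (hφ : HasPVarBound p φ s A)
    (hg : HasPVarBound q g s B) (n : ℕ) (u : ℕ → ℝ) (hu : Monotone u) (hus : ∀ i ≤ n, u i ∈ s) :
    |stieltjesSum φ g u n - φ (u 0) * (g (u n) - g (u 0))| ≤ youngConst p q * A * B := by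
  refine (abs_stieltjesSum_sub_le_sum hp hq hA hB hφ hg n u hu hus).trans ?_
  rw [show youngConst p q * A * B = A * B * youngConst p q by ring]
  gcongr
  exact (Real.summable_nat_rpow_inv.2 hpq).sum_le_tsum _ fun _ _ => by positivity

/-! ### Calculus of `p`-variation bounds. -/

namespace HasPVarBound

variable {p q : ℝ} {f g : ℝ → ℝ} {s : Set ℝ} {A B : ℝ}

theorem of_pVariationOn (hp : 0 < p) (h : pVariationOn p f s < ∞) :
    HasPVarBound p f s (pVariationOn p f s).toReal := by
  intro n u hu hus
  -- `pVariationOn` wants every term of the sequence in `s`, so the sequence is frozen after index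
  -- `n`.
  have hv : Monotone fun k => u (min k n) := fun a b hab => hu (by omega)
  have h1 := le_iSup (fun x : ℕ × {u : ℕ → ℝ // Monotone u ∧ ∀ i, u i ∈ s} =>
    (∑ k ∈ Finset.range x.1, edist (f (x.2.1 (k + 1))) (f (x.2.1 k)) ^ p) ^ (1 / p))
    ⟨n, ⟨fun k => u (min k n), hv, fun i => hus _ (min_le_right _ _)⟩⟩
  have h2 : ∑ k ∈ Finset.range n, edist (f (u (min (k + 1) n))) (f (u (min k n))) ^ p =
      ENNReal.ofReal (∑ k ∈ Finset.range n, |f (u (k + 1)) - f (u k)| ^ p) := by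
    rw [ENNReal.ofReal_sum_of_nonneg fun _ _ => by positivity]
    refine Finset.sum_congr rfl fun k hk => ?_
    have := Finset.mem_range.1 hk
    rw [min_eq_left (by omega), min_eq_left (by omega), edist_dist, Real.dist_eq,
      ENNReal.ofReal_rpow_of_nonneg (abs_nonneg _) hp.le]
  simp only [h2] at h1
  have h3 : (ENNReal.ofReal (∑ k ∈ Finset.range n, |f (u (k + 1)) - f (u k)| ^ p)) ≤
      (pVariationOn p f s) ^ p := by
    have := ENNReal.rpow_le_rpow h1 hp.le
    rwa [← ENNReal.rpow_mul, one_div_mul_cancel hp.ne', ENNReal.rpow_one] at this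
  have h4 := ENNReal.toReal_mono (ENNReal.rpow_ne_top_of_nonneg hp.le h.ne) h3
  rwa [ENNReal.toReal_ofReal (Finset.sum_nonneg fun _ _ => by positivity),
    ← ENNReal.toReal_rpow] at h4

theorem mono_set {s' : Set ℝ} (h : HasPVarBound p f s A) (hs : s' ⊆ s) : HasPVarBound p f s' A :=
  fun n u hu hus => h n u hu fun i hi => hs (hus i hi)

theorem mono_bound (hp : 0 ≤ p) (hA : 0 ≤ A) (h : HasPVarBound p f s A) (hAB : A ≤ B) :
    HasPVarBound p f s B :=
  fun n u hu hus => (h n u hu hus).trans (Real.rpow_le_rpow hA hAB hp)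

theorem comp_monotone {s' : Set ℝ} {l : ℝ → ℝ} (h : HasPVarBound p f s A) (hl : Monotone l)
    (hs : Set.MapsTo l s' s) : HasPVarBound p (f ∘ l) s' A :=
  fun n u hu hus => h n (l ∘ u) (hl.comp hu) fun i hi => hs (hus i hi)

theorem sub (hp : 1 ≤ p) (hA : 0 ≤ A) (hB : 0 ≤ B) (hf : HasPVarBound p f s A)
    (hg : HasPVarBound p g s B) : HasPVarBound p (f - g) s (A + B) := by
  intro n u hu hus
  have hp0 : 0 < p := by linarith
  have h1 := Real.Lp_add_le (Finset.range n) (fun k => f (u (k + 1)) - f (u k))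
    (fun k => -(g (u (k + 1)) - g (u k))) hp
  simp only [abs_neg] at h1
  have key : ∀ {x y : ℝ}, 0 ≤ x → 0 ≤ y → y ≤ x ^ p → y ^ (1 / p) ≤ x := fun {x y} hx hy h => by
    calc y ^ (1 / p) ≤ (x ^ p) ^ (1 / p) := by gcongr
      _ = x := by rw [← Real.rpow_mul hx, mul_one_div_cancel hp0.ne', Real.rpow_one]
  have h2 := h1.trans (add_le_add
    (key hA (Finset.sum_nonneg fun _ _ => by positivity) (hf n u hu hus))
    (key hB (Finset.sum_nonneg fun _ _ => by positivity) (hg n u hu hus)))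
  have h3 := Real.rpow_le_rpow (Real.rpow_nonneg (Finset.sum_nonneg fun _ _ => by positivity) _)
    h2 hp0.le
  rw [← Real.rpow_mul (Finset.sum_nonneg fun _ _ => by positivity), one_div_mul_cancel hp0.ne',
    Real.rpow_one] at h3
  convert h3 using 5
  simp only [Pi.sub_apply]
  ring

theorem abs_sub_le (hp : 0 < p) (hA : 0 ≤ A) (h : HasPVarBound p f s A) {x y : ℝ} (hx : x ∈ s)
    (hy : y ∈ s) : |f x - f y| ≤ A := by
  wlog hxy : y ≤ x generalizing x y
  · rw [abs_sub_comm]; exact this hy hx (le_of_not_ge hxy)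
  have h1 := h 1 (fun k => if k = 0 then y else x)
    (by intro a b hab; beta_reduce; split_ifs <;> first | omega | simp)
    (by intro i _; split_ifs <;> assumption)
  simp only [Finset.range_one, Finset.sum_singleton, zero_add, one_ne_zero, if_false, if_true] at h1
  exact (Real.rpow_le_rpow_iff (abs_nonneg _) hA hp).1 h1

/-- Interpolation between the `p`-variation and the supremum norm. -/
theorem interpolate {r M : ℝ} (hp : 0 < p) (hpr : p < r) (hA : 0 ≤ A)
    (h : HasPVarBound p f s A) (hM : 0 ≤ M) (hf : ∀ x ∈ s, |f x| ≤ M) :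
    HasPVarBound r f s ((2 * M) ^ (1 - p / r) * A ^ (p / r)) := by
  intro n u hu hus
  have hr : 0 < r := hp.trans hpr
  calc ∑ k ∈ Finset.range n, |f (u (k + 1)) - f (u k)| ^ r
      ≤ ∑ k ∈ Finset.range n, (2 * M) ^ (r - p) * |f (u (k + 1)) - f (u k)| ^ p := by
        refine Finset.sum_le_sum fun k hk => ?_
        have hk := Finset.mem_range.1 hk
        have h1 : |f (u (k + 1)) - f (u k)| ≤ 2 * M := by
          have h1 := hf _ (hus (k + 1) (by omega))
          have h2 := hf _ (hus k (by omega))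
          linarith [abs_sub (f (u (k + 1))) (f (u k))]
        calc |f (u (k + 1)) - f (u k)| ^ r
            = |f (u (k + 1)) - f (u k)| ^ (r - p) * |f (u (k + 1)) - f (u k)| ^ p := by
              rw [← Real.rpow_add_of_nonneg (abs_nonneg _) (by linarith) hp.le, sub_add_cancel]
          _ ≤ _ := by
              have : 0 ≤ r - p := by linarith
              gcongr
    _ ≤ (2 * M) ^ (r - p) * A ^ p := by
        rw [← Finset.mul_sum]
        gcongr
        exact h n u hu hus
    _ = ((2 * M) ^ (1 - p / r) * A ^ (p / r)) ^ r := by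
        rw [Real.mul_rpow (x := (2 * M) ^ (1 - p / r)) (by positivity) (by positivity),
          ← Real.rpow_mul (by positivity), ← Real.rpow_mul hA]
        congr 2 <;> field_simp

theorem of_tendsto {F : ℕ → ℝ → ℝ} (hp : 0 ≤ p) (hF : ∀ n, HasPVarBound p (F n) s A)
    (h : ∀ x, Tendsto (fun n => F n x) atTop (𝓝 (f x))) : HasPVarBound p f s A := by
  intro n u hu hus
  refine le_of_tendsto' (f := fun m => ∑ k ∈ Finset.range n, |F m (u (k + 1)) - F m (u k)| ^ p)
    (x := atTop) ?_ fun m => hF m n u hu hus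
  refine tendsto_finsetSum _ fun k _ => ?_
  exact (((h _).sub (h _)).abs).rpow_const (Or.inr hp)

end HasPVarBound

/-- Riemann-Stieltjes sums of functions which are uniformly small and of bounded `p`-variation are
small, uniformly over all partitions. -/
theorem exists_abs_stieltjesSum_lt {p q : ℝ} (hp : 1 ≤ p) (hq : 1 ≤ q) (hpq : 1 < 1 / p + 1 / q)
    {g : ℝ → ℝ} {s : Set ℝ} {A B : ℝ} (hA : 0 ≤ A) (hB : 0 ≤ B) (hg : HasPVarBound q g s B)
    {ε : ℝ} (hε : 0 < ε) :
    ∃ δ > 0, ∀ φ : ℝ → ℝ, HasPVarBound p φ s A → (∀ x ∈ s, |φ x| ≤ δ) →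
      ∀ (n : ℕ) (u : ℕ → ℝ), Monotone u → (∀ i ≤ n, u i ∈ s) → |stieltjesSum φ g u n| < ε := by
  have hp0 : 0 < p := by linarith
  have hq0 : 0 < q := by linarith
  have hq1 : 1 / q ≤ 1 := by rw [div_le_one hq0]; exact hq
  have hp1 : 0 < 1 / p := by positivity
  -- `1/r` is the midpoint of `1 - 1/q` and `1/p`, so that both `p < r` and `1/r + 1/q > 1`.
  set r : ℝ := 1 / ((1 / p + 1 - 1 / q) / 2) with hr
  have hden : 0 < (1 / p + 1 - 1 / q) / 2 := by linarith
  have hr0 : 0 < r := by positivity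
  have hr1 : 1 / r = (1 / p + 1 - 1 / q) / 2 := by rw [hr, one_div_one_div]
  have hpr : p < r := by
    rw [← one_div_lt_one_div hr0 hp0, hr1]; linarith
  have hrq : 1 < 1 / r + 1 / q := by rw [hr1]; linarith
  have hexp : 0 < 1 - p / r := by
    have : p / r < 1 := by rw [div_lt_one hr0]; exact hpr
    linarith
  have hlim : Tendsto (fun δ : ℝ => youngConst r q * ((2 * δ) ^ (1 - p / r) * A ^ (p / r)) * B +
      δ * B) (𝓝 0) (𝓝 0) := by
    have h1 : Tendsto (fun δ : ℝ => (2 * δ) ^ (1 - p / r)) (𝓝 0) (𝓝 0) := by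
      have : Tendsto (fun δ : ℝ => 2 * δ) (𝓝 0) (𝓝 0) := by
        simpa using (tendsto_id (x := 𝓝 (0 : ℝ))).const_mul 2
      simpa [Real.zero_rpow hexp.ne'] using this.rpow_const (Or.inr hexp.le)
    simpa using (((h1.mul_const (A ^ (p / r))).const_mul (youngConst r q)).mul_const B).add
      ((tendsto_id (x := 𝓝 (0 : ℝ))).mul_const B)
  obtain ⟨δ, hδε, hδ⟩ := (((hlim.mono_left nhdsWithin_le_nhds).eventually_lt_const hε).and
    (self_mem_nhdsWithin (s := Set.Ioi (0 : ℝ)))).exists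
  have hδ : 0 < δ := hδ
  refine ⟨δ, hδ, fun φ hφ hφδ n u hu hus => ?_⟩
  have h1 := abs_stieltjesSum_sub_le hr0 hq0 hrq (by positivity) hB
    (hφ.interpolate hp0 hpr hA hδ.le hφδ) hg n u hu hus
  have h2 : |φ (u 0) * (g (u n) - g (u 0))| ≤ δ * B := by
    rw [abs_mul]
    exact mul_le_mul (hφδ _ (hus 0 (by omega)))
      (hg.abs_sub_le hq0 hB (hus n le_rfl) (hus 0 (by omega))) (abs_nonneg _) hδ.le
  have h3 := abs_sub_abs_le_abs_sub (stieltjesSum φ g u n) (φ (u 0) * (g (u n) - g (u 0)))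
  linarith

theorem stieltjesSum_sub (φ ψ g : ℝ → ℝ) (u : ℕ → ℝ) (n : ℕ) :
    stieltjesSum (φ - ψ) g u n = stieltjesSum φ g u n - stieltjesSum ψ g u n := by
  simp only [stieltjesSum, Pi.sub_apply, sub_mul, Finset.sum_sub_distrib]

/-! ### Uniform grids and step functions. -/

/-- The grid of mesh `(b - a) / (N + 1)` starting in `a`; its point with index `N + 1` is `b`. -/
noncomputable def uniformGrid (a b : ℝ) (N k : ℕ) : ℝ := a + k * ((b - a) / (N + 1))

section uniformGrid

variable {a b : ℝ} (N : ℕ)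

theorem uniformGrid_zero : uniformGrid a b N 0 = a := by simp [uniformGrid]

theorem uniformGrid_last : uniformGrid a b N (N + 1) = b := by
  have : (N : ℝ) + 1 ≠ 0 := by positivity
  rw [uniformGrid]; push_cast; field_simp; ring

theorem uniformGrid_succ (k : ℕ) :
    uniformGrid a b N (k + 1) = uniformGrid a b N k + (b - a) / (N + 1) := by
  rw [uniformGrid, uniformGrid]; push_cast; ring

theorem monotone_uniformGrid (hab : a ≤ b) : Monotone (uniformGrid a b N) :=
  monotone_nat_of_le_succ fun k => by
    rw [uniformGrid_succ]
    have : 0 ≤ (b - a) / ((N : ℝ) + 1) := div_nonneg (by linarith) (by positivity)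
    linarith

theorem uniformGrid_mem_Icc (hab : a ≤ b) {k : ℕ} (hk : k ≤ N + 1) :
    uniformGrid a b N k ∈ Set.Icc a b := by
  have h := monotone_uniformGrid N hab
  constructor
  · simpa [uniformGrid_zero] using h (Nat.zero_le k)
  · simpa [uniformGrid_last] using h hk

theorem tendsto_uniformGrid_mesh :
    Tendsto (fun N : ℕ => (b - a) / ((N : ℝ) + 1)) atTop (𝓝 0) := by
  simpa [div_eq_mul_inv] using (tendsto_one_div_add_atTop_nhds_zero_nat (𝕜 := ℝ)).const_mul (b - a)

end uniformGrid

/-- By monotonicity the indices with `u k ≤ x` form an initial segment, so the sum telescopes. -/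
theorem exists_sum_ite_eq {u : ℕ → ℝ} (hu : Monotone u) (g : ℝ → ℝ) (x : ℝ) (n : ℕ) :
    ∃ m ≤ n, g (u 0) + ∑ k ∈ Finset.range n, (if u k ≤ x then g (u (k + 1)) - g (u k) else 0) =
      g (u m) ∧ (∀ k < m, u k ≤ x) ∧ (m < n → x < u m) := by
  induction n with
  | zero => exact ⟨0, le_rfl, by simp⟩
  | succ n ih =>
    obtain ⟨m, hmn, heq, hle, hlt⟩ := ih
    rw [Finset.sum_range_succ, ← add_assoc, heq]
    rcases hmn.lt_or_eq with h | rfl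
    · refine ⟨m, by omega, ?_, hle, fun _ => hlt h⟩
      rw [if_neg (not_le.2 ((hlt h).trans_le (hu hmn))), add_zero]
    · by_cases hx : u m ≤ x
      · refine ⟨m + 1, le_rfl, by rw [if_pos hx]; ring, fun k hk => ?_, fun h => by omega⟩
        exact (hu (by omega)).trans hx
      · exact ⟨m, by omega, by rw [if_neg hx, add_zero], hle, fun _ => not_le.1 hx⟩

/-- The right-continuous step function which on each interval `[e_k, e_{k+1})` of the uniform grid
of `[a,b]` takes the value `g(e_{k+1})`. -/
noncomputable def stepApprox (g : ℝ → ℝ) (a b : ℝ) (N : ℕ) (x : ℝ) : ℝ :=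
  g a + stieltjesSum (fun e => if e ≤ x then 1 else 0) g (uniformGrid a b N) (N + 1)

theorem exists_stepApprox_eq (g : ℝ → ℝ) {a b x : ℝ} (hx : x ∈ Set.Icc a b) (N : ℕ) :
    ∃ y, stepApprox g a b N x = g y ∧ x ≤ y ∧ y ≤ b ∧ y ≤ x + (b - a) / (N + 1) := by
  have hab : a ≤ b := hx.1.trans hx.2
  obtain ⟨m, hm, heq, hle, hlt⟩ := exists_sum_ite_eq (monotone_uniformGrid N hab) g x (N + 1)
  refine ⟨uniformGrid a b N m, ?_, ?_, (uniformGrid_mem_Icc N hab hm).2, ?_⟩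
  · rw [← heq, stepApprox, stieltjesSum, uniformGrid_zero]
    simp only [ite_mul, one_mul, zero_mul]
  · rcases hm.lt_or_eq with h | rfl
    · exact (hlt h).le
    · rw [uniformGrid_last]; exact hx.2
  · rcases m with _ | m
    · exact absurd (hlt (by omega)) (by rw [uniformGrid_zero]; exact not_lt.2 hx.1)
    · rw [uniformGrid_succ]
      linarith [hle m (by omega)]

/-- The value is that of `g` at a point at most one mesh to the right of `x`, so right-continuity is
enough. -/
theorem tendsto_stepApprox {g : ℝ → ℝ} (hg : RightContinuous g) {a b x : ℝ}
    (hx : x ∈ Set.Icc a b) : Tendsto (fun N => stepApprox g a b N x) atTop (𝓝 (g x)) := by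
  choose y hy hxy _ hyx using exists_stepApprox_eq g hx
  simp only [hy]
  refine (hg x).tendsto.comp (tendsto_nhdsWithin_iff.2 ⟨?_, Eventually.of_forall hxy⟩)
  refine tendsto_of_tendsto_of_tendsto_of_le_of_le tendsto_const_nhds ?_ hxy hyx
  simpa using tendsto_const_nhds.add (tendsto_uniformGrid_mesh (a := a) (b := b))

/-- The largest of the points `u_0, …, u_m` which lies strictly below `x`, and `u_0` if there is
none. -/
noncomputable def leftPoint (u : ℕ → ℝ) (m : ℕ) (x : ℝ) : ℝ :=
  open Classical in u (Nat.findGreatest (fun i => u i < x) m)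

theorem monotone_leftPoint {u : ℕ → ℝ} (hu : Monotone u) (m : ℕ) : Monotone (leftPoint u m) := by
  classical
  intro x y hxy
  exact hu (Nat.findGreatest_mono (fun i hi => lt_of_lt_of_le hi hxy) le_rfl)

theorem leftPoint_mem_Icc {u : ℕ → ℝ} (hu : Monotone u) (m : ℕ) (x : ℝ) :
    leftPoint u m x ∈ Set.Icc (u 0) (u m) := by
  classical
  exact ⟨hu (Nat.zero_le _), hu (Nat.findGreatest_le _)⟩

theorem abs_sub_leftPoint_lt {u : ℕ → ℝ} {m : ℕ} {δ : ℝ}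
    (hδ : ∀ i < m + 1, u (i + 1) - u i < δ) {x : ℝ} (hx : x ∈ Set.Icc (u 0) (u (m + 1))) :
    |x - leftPoint u m x| < δ := by
  classical
  rw [leftPoint]
  set k := Nat.findGreatest (fun i => u i < x) m with hk
  have hkm : k ≤ m := Nat.findGreatest_le _
  have h1 : u k ≤ x := by
    by_cases h0 : k = 0
    · rw [h0]; exact hx.1
    · exact (Nat.findGreatest_of_ne_zero hk.symm h0).le
  have h2 : x ≤ u (k + 1) := by
    rcases hkm.lt_or_eq with h | h
    · exact not_lt.1 (Nat.findGreatest_is_greatest (P := fun i => u i < x) (n := m)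
        (Nat.lt_succ_self k) h)
    · rw [h]; exact hx.2
  rw [abs_of_nonneg (by linarith)]
  linarith [hδ k (by omega)]

theorem comp_leftPoint_eq_sum (φ : ℝ → ℝ) {u : ℕ → ℝ} (hu : Monotone u) (m : ℕ) (x : ℝ) :
    φ (leftPoint u m x) = φ (u m) +
      ∑ i ∈ Finset.range m, (φ (u i) - φ (u (i + 1))) * (if x ≤ u (i + 1) then 1 else 0) := by
  classical
  rw [leftPoint]
  induction m with
  | zero => simp
  | succ m ih =>
    rw [Nat.findGreatest_succ]
    by_cases hx : u (m + 1) < x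
    · rw [if_pos hx, Finset.sum_eq_zero, add_zero]
      intro i hi
      have := Finset.mem_range.1 hi
      rw [if_neg, mul_zero]
      exact not_le.2 ((hu (by omega)).trans_lt hx)
    · rw [if_neg hx, ih, Finset.sum_range_succ, if_pos (not_lt.1 hx)]
      ring

theorem stieltjesSum_by_parts (φ g : ℝ → ℝ) (u : ℕ → ℝ) (m : ℕ) :
    stieltjesSum φ g u (m + 1) = φ (u m) * (g (u (m + 1)) - g (u 0)) +
      ∑ i ∈ Finset.range m, (φ (u i) - φ (u (i + 1))) * (g (u (i + 1)) - g (u 0)) := by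
  induction m with
  | zero => simp [stieltjesSum]
  | succ m ih =>
    rw [stieltjesSum, Finset.sum_range_succ, ← stieltjesSum, ih, Finset.sum_range_succ]
    ring

/-- `φ ∘ leftPoint` is a combination of indicators of `x ≤ u (i + 1)`, the strict inequality in
`leftPoint` making them closed on the right. The grid sum of such an indicator is an increment of
`stepApprox`, which converges; summation by parts reassembles the limit. -/
theorem tendsto_stieltjesSum_comp_leftPoint (φ : ℝ → ℝ) {g : ℝ → ℝ} (hg : RightContinuous g)
    {u : ℕ → ℝ} (hu : Monotone u) (m : ℕ) :
    Tendsto (fun N => stieltjesSum (φ ∘ leftPoint u m) g (uniformGrid (u 0) (u (m + 1)) N) (N + 1))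
      atTop (𝓝 (stieltjesSum φ g u (m + 1))) := by
  have h : ∀ N, stieltjesSum (φ ∘ leftPoint u m) g (uniformGrid (u 0) (u (m + 1)) N) (N + 1) =
      φ (u m) * (g (u (m + 1)) - g (u 0)) + ∑ i ∈ Finset.range m, (φ (u i) - φ (u (i + 1))) *
        (stepApprox g (u 0) (u (m + 1)) N (u (i + 1)) - g (u 0)) := by
    intro N
    have h1 : ∑ k ∈ Finset.range (N + 1), (g (uniformGrid (u 0) (u (m + 1)) N (k + 1)) -
        g (uniformGrid (u 0) (u (m + 1)) N k)) = g (u (m + 1)) - g (u 0) := by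
      rw [Finset.sum_range_sub (fun k => g (uniformGrid (u 0) (u (m + 1)) N k)), uniformGrid_last,
        uniformGrid_zero]
    rw [← h1, Finset.mul_sum]
    simp only [stepApprox, stieltjesSum, Function.comp_apply, comp_leftPoint_eq_sum φ hu,
      add_sub_cancel_left, Finset.mul_sum, add_mul, Finset.sum_mul, Finset.sum_add_distrib]
    rw [Finset.sum_comm (s := Finset.range m)]
    simp only [mul_assoc]
  simp only [h]
  rw [stieltjesSum_by_parts]
  refine tendsto_const_nhds.add (tendsto_finsetSum _ fun i hi => ?_)
  have hi := Finset.mem_range.1 hi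
  exact ((tendsto_stepApprox hg ⟨hu (by omega), hu (by omega)⟩).sub_const _).const_mul _

/-! ### Existence of the Young integral. -/

section Young

variable {p q : ℝ} {φ g : ℝ → ℝ} {a b A B : ℝ}

/-- Grid sums of `φ ∘ leftPoint u m` converge to the sum over `u`. When the mesh of `u` is small, `φ
- φ ∘ leftPoint u m` is uniformly small with `p`-variation at most `A + A`, so its grid sums are
small for every `N`. -/
theorem eventually_abs_uniformGrid_sum_sub_lt (hp : 1 ≤ p) (hq : 1 ≤ q)
    (hpq : 1 < 1 / p + 1 / q) (hab : a ≤ b) (hA : 0 ≤ A) (hB : 0 ≤ B)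
    (hφc : ContinuousOn φ (Set.Icc a b)) (hφ : HasPVarBound p φ (Set.Icc a b) A)
    (hgc : RightContinuous g) (hg : HasPVarBound q g (Set.Icc a b) B) {ε : ℝ} (hε : 0 < ε) :
    ∃ δ > 0, ∀ (n : ℕ) (u : ℕ → ℝ), Monotone u → u 0 = a → u n = b →
      (∀ i < n, u (i + 1) - u i < δ) → ∀ᶠ N in atTop,
        |stieltjesSum φ g (uniformGrid a b N) (N + 1) - stieltjesSum φ g u n| < ε := by
  obtain ⟨η, hη, hsmall⟩ := exists_abs_stieltjesSum_lt hp hq hpq (add_nonneg hA hA) hB hg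
    (half_pos hε)
  obtain ⟨δ, hδ, hunif⟩ := Metric.uniformContinuousOn_iff.1
    (isCompact_Icc.uniformContinuousOn_of_continuous hφc) η hη
  refine ⟨δ, hδ, fun n u hu h0 hn hmesh => ?_⟩
  rcases n with _ | m
  · have : a = b := h0.symm.trans hn
    subst this
    simp [stieltjesSum, uniformGrid, hε]
  have hmem : ∀ x, leftPoint u m x ∈ Set.Icc a b := fun x => by
    have h := leftPoint_mem_Icc hu m x
    exact ⟨h0 ▸ h.1, hn ▸ h.2.trans (hu (by omega))⟩
  have hlim := tendsto_stieltjesSum_comp_leftPoint φ hgc hu m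
  rw [h0, hn] at hlim
  filter_upwards [Metric.tendsto_nhds.1 hlim _ (half_pos hε)] with N hN
  have h1 := hsmall (φ - φ ∘ leftPoint u m)
    (hφ.sub hp hA hA (hφ.comp_monotone (monotone_leftPoint hu m) fun x _ => hmem x))
    (fun x hx => (hunif x hx _ (hmem x)
      (abs_sub_leftPoint_lt hmesh (by rwa [h0, hn]))).le)
    (N + 1) (uniformGrid a b N) (monotone_uniformGrid N hab)
    (fun i hi => uniformGrid_mem_Icc N hab hi)
  rw [stieltjesSum_sub] at h1
  rw [Real.dist_eq] at hN
  calc _ ≤ _ := abs_sub_le _ (stieltjesSum (φ ∘ leftPoint u m) g (uniformGrid a b N) (N + 1)) _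
    _ < ε := by linarith

/-- Existence of the Young integral for a continuous integrand of finite `p`-variation and a
right-continuous integrator of finite `q`-variation. -/
theorem exists_hasYoungIntegralOn (hp : 1 ≤ p) (hq : 1 ≤ q)
    (hpq : 1 < 1 / p + 1 / q) (hab : a ≤ b) (hA : 0 ≤ A) (hB : 0 ≤ B)
    (hφc : ContinuousOn φ (Set.Icc a b)) (hφ : HasPVarBound p φ (Set.Icc a b) A)
    (hgc : RightContinuous g) (hg : HasPVarBound q g (Set.Icc a b) B) :
    ∃ J, HasYoungIntegralOn φ g a b J ∧
      Tendsto (fun N => stieltjesSum φ g (uniformGrid a b N) (N + 1)) atTop (𝓝 J) := by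
  have key := fun ε (hε : (0 : ℝ) < ε) => eventually_abs_uniformGrid_sum_sub_lt hp hq hpq hab hA hB
    hφc hφ hgc hg hε
  have hC : CauchySeq fun N => stieltjesSum φ g (uniformGrid a b N) (N + 1) := by
    rw [Metric.cauchySeq_iff]
    intro ε hε
    obtain ⟨δ, hδ, h⟩ := key _ (half_pos hε)
    obtain ⟨M, hM⟩ := ((tendsto_uniformGrid_mesh (a := a) (b := b)).eventually_lt_const hδ).exists
    obtain ⟨N₀, hN₀⟩ := eventually_atTop.1 (h (M + 1) (uniformGrid a b M)
      (monotone_uniformGrid M hab) (uniformGrid_zero M) (uniformGrid_last M)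
      (fun i _ => by rw [uniformGrid_succ]; linarith))
    refine ⟨N₀, fun m hm n hn => ?_⟩
    have h1 := hN₀ m hm
    have h2 := hN₀ n hn
    rw [Real.dist_eq]
    calc _ ≤ _ := abs_sub_le _ (stieltjesSum φ g (uniformGrid a b M) (M + 1)) _
      _ < ε := by rw [abs_sub_comm _ (stieltjesSum φ g (uniformGrid a b n) (n + 1))]; linarith
  obtain ⟨J, hJ⟩ := cauchySeq_tendsto_of_complete hC
  refine ⟨J, fun ε hε => ?_, hJ⟩
  obtain ⟨δ, hδ, h⟩ := key _ (half_pos hε)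
  refine ⟨δ, hδ, fun n u hu h0 hn hmesh => ?_⟩
  have h1 : |J - stieltjesSum φ g u n| ≤ ε / 2 :=
    le_of_tendsto (hJ.sub_const _).abs ((h n u hu h0 hn hmesh).mono fun N hN => hN.le)
  rw [abs_sub_comm]
  exact h1.trans_lt (half_lt_self hε)

end Young

/-! ### Tanaka formula for a single step. -/

/-- The contribution `1_{⦅c,d⟧}(e) |d - e|` of a single step from `c` to `d` to the discrete local
time in `e`. -/
noncomputable def stepKernel (c d e : ℝ) : ℝ := (Set.uIoc c d).indicator (fun v => |d - v|) e

theorem intervalIntegrable_ite_le (e c d : ℝ) :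
    IntervalIntegrable (fun x : ℝ => if e ≤ x then (1 : ℝ) else 0) volume c d := by
  refine Monotone.intervalIntegrable fun x y hxy => ?_
  by_cases h : e ≤ x
  · simp [h, h.trans hxy]
  · simp only [h, if_false]
    split_ifs <;> norm_num

theorem integral_ite_le (e c d : ℝ) :
    ∫ x in c..d, (if e ≤ x then (1 : ℝ) else 0) = max (d - e) 0 - max (c - e) 0 := by
  refine intervalIntegral.integral_eq_sub_of_hasDeriv_right (f := fun x => max (x - e) 0)
    (by fun_prop) (fun x _ => ?_) (intervalIntegrable_ite_le e c d)
  by_cases h : e ≤ x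
  · rw [if_pos h]
    refine ((hasDerivAt_id x).sub_const e).hasDerivWithinAt.congr (fun y hy => ?_) ?_
    · have : x < y := hy
      simp only [id]
      exact max_eq_left (by linarith)
    · simp only [id]
      exact max_eq_left (by linarith)
  · rw [if_neg h]
    have h := not_le.1 h
    refine HasDerivAt.hasDerivWithinAt ((hasDerivAt_const x (0 : ℝ)).congr_of_eventuallyEq ?_)
    filter_upwards [Iio_mem_nhds h] with y hy
    have : y < e := hy
    exact max_eq_right (by linarith)

theorem stepKernel_eq_integral (c d e : ℝ) :
    stepKernel c d e =
      ∫ x in c..d, ((if e ≤ x then (1 : ℝ) else 0) - (if e ≤ c then 1 else 0)) := by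
  rw [intervalIntegral.integral_sub (intervalIntegrable_ite_le e c d) intervalIntegrable_const,
    integral_ite_le, intervalIntegral.integral_const, stepKernel, smul_eq_mul]
  by_cases h : e ∈ Set.uIoc c d
  · rw [Set.indicator_of_mem h]
    rcases Set.mem_uIoc.1 h with h | h
    · rw [if_neg (by linarith [h.1]), abs_of_nonneg (by linarith), max_eq_left (by linarith),
        max_eq_right (by linarith)]
      ring
    · rw [if_pos h.2, abs_of_neg (by linarith), max_eq_right (by linarith),
        max_eq_left (by linarith)]
      ring
  · rw [Set.indicator_of_notMem h]
    rw [Set.mem_uIoc] at h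
    push Not at h
    by_cases hc : e ≤ c
    · rw [if_pos hc, max_eq_left (a := c - e) (by linarith)]
      have : e ≤ d := by
        by_contra hd
        exact absurd (h.2 (not_le.1 hd)) (not_lt.2 hc)
      rw [max_eq_left (by linarith)]
      ring
    · have hd := h.1 (not_le.1 hc)
      rw [if_neg hc, max_eq_right (by linarith), max_eq_right (by linarith)]
      ring

theorem stieltjesSum_stepKernel (g : ℝ → ℝ) (a b c d : ℝ) (N : ℕ) :
    stieltjesSum (stepKernel c d) g (uniformGrid a b N) (N + 1) =
      ∫ x in c..d, (stepApprox g a b N x - stepApprox g a b N c) := by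
  simp only [stepApprox, add_sub_add_left_eq_sub, stieltjesSum, ← Finset.sum_sub_distrib, ← sub_mul]
  rw [intervalIntegral.integral_finsetSum]
  · simp only [stepKernel_eq_integral, intervalIntegral.integral_mul_const]
  · intro i _
    exact ((intervalIntegrable_ite_le _ c d).sub intervalIntegrable_const).mul_const _

theorem intervalIntegrable_stepApprox (g : ℝ → ℝ) (a b c d : ℝ) (N : ℕ) :
    IntervalIntegrable (stepApprox g a b N) volume c d := by
  refine intervalIntegrable_const.add ?_
  simp only [stieltjesSum]
  have := IntervalIntegrable.sum (Finset.range (N + 1))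
    (f := fun i x => (if uniformGrid a b N i ≤ x then (1 : ℝ) else 0) *
      (g (uniformGrid a b N (i + 1)) - g (uniformGrid a b N i))) (μ := volume) (a := c) (b := d)
    fun i _ => (intervalIntegrable_ite_le _ c d).mul_const _
  rwa [Finset.sum_fn] at this

section

variable {q : ℝ} {g : ℝ → ℝ} {a b c d B : ℝ}

/-- Dominated convergence: step approximations take values of `g` at points of `[a,b]`, so their
differences are bounded by `B`. -/
theorem tendsto_stieltjesSum_stepKernel (hq : 0 < q) (hB : 0 ≤ B) (hgc : RightContinuous g)
    (hg : HasPVarBound q g (Set.Icc a b) B) (hc : c ∈ Set.Icc a b) (hd : d ∈ Set.Icc a b) :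
    Tendsto (fun N => stieltjesSum (stepKernel c d) g (uniformGrid a b N) (N + 1)) atTop
      (𝓝 (∫ x in c..d, (g x - g c))) := by
  simp only [stieltjesSum_stepKernel]
  have hsub : Set.uIoc c d ⊆ Set.Icc a b :=
    Set.uIoc_subset_uIcc.trans (Set.ordConnected_Icc.uIcc_subset hc hd)
  refine intervalIntegral.tendsto_integral_filter_of_dominated_convergence (fun _ => B)
    (Eventually.of_forall fun N => ?_) (Eventually.of_forall fun N => ?_) intervalIntegrable_const
    (Eventually.of_forall fun x hx => ?_)
  · exact ((intervalIntegrable_stepApprox g a b c d N).sub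
      intervalIntegrable_const).aestronglyMeasurable_restrict_uIoc
  · refine Eventually.of_forall fun x hx => ?_
    obtain ⟨y, hy, hxy, hyb, -⟩ := exists_stepApprox_eq g (hsub hx) N
    obtain ⟨z, hz, hcz, hzb, -⟩ := exists_stepApprox_eq g hc N
    rw [hy, hz, Real.norm_eq_abs]
    exact hg.abs_sub_le hq hB ⟨(hsub hx).1.trans hxy, hyb⟩ ⟨hc.1.trans hcz, hzb⟩
  · exact (tendsto_stepApprox hgc (hsub hx)).sub (tendsto_stepApprox hgc hc)

theorem intervalIntegrable_of_hasPVarBound (hq : 0 < q) (hB : 0 ≤ B) (hgc : RightContinuous g)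
    (hg : HasPVarBound q g (Set.Icc a b) B) (hc : c ∈ Set.Icc a b) (hd : d ∈ Set.Icc a b) :
    IntervalIntegrable g volume c d := by
  have hsub : Set.uIoc c d ⊆ Set.Icc a b :=
    Set.uIoc_subset_uIcc.trans (Set.ordConnected_Icc.uIcc_subset hc hd)
  have hmeas : AEStronglyMeasurable g (volume.restrict (Set.uIoc c d)) :=
    aestronglyMeasurable_of_tendsto_ae atTop
      (fun N => (intervalIntegrable_stepApprox g a b c d N).aestronglyMeasurable_restrict_uIoc)
      ((ae_restrict_mem measurableSet_uIoc).mono fun x hx => tendsto_stepApprox hgc (hsub hx))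
  refine (intervalIntegrable_const (c := |g c| + B)).mono_fun hmeas ?_
  refine (ae_restrict_mem measurableSet_uIoc).mono fun x hx => ?_
  have h1 := hg.abs_sub_le hq hB (hsub hx) hc
  have h2 := abs_sub_abs_le_abs_sub (g x) (g c)
  change |g x| ≤ |(|g c| + B)|
  exact le_trans (by linarith) (le_abs_self _)

end

/-! ### Discrete local times and the discrete Tanaka-Meyer formula. -/

namespace TimePartition

variable (π : TimePartition)

theorem stopped_zero (t : ℝ≥0) : π.stopped 0 t = 0 := by simp [stopped, π.pt_zero]

theorem stopped_le (j : ℕ) (t : ℝ≥0) : π.stopped j t ≤ t := by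
  rw [stopped]
  exact ENNReal.toNNReal_mono ENNReal.coe_ne_top (min_le_right _ _)

theorem stopped_of_le {j : ℕ} {t : ℝ≥0} (h : (t : ℝ≥0∞) ≤ π.pt j) : π.stopped j t = t := by
  rw [stopped, min_eq_right h, ENNReal.toNNReal_coe]

theorem exists_stopped_eq (t : ℝ≥0) : ∃ K, ∀ j ≥ K, π.stopped j t = t := by
  obtain ⟨K, hK⟩ := eventually_atTop.1 (Tendsto.eventually_const_lt
    (ENNReal.coe_lt_top (r := t)) π.tendsto_top)
  exact ⟨K, fun j hj => π.stopped_of_le (hK j hj).le⟩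

/-- Once `t ≤ t_j` the increment vanishes, so `g` only matters on the range of `S` up to time `t`.
-/
theorem mul_increment_eq (S : ℝ≥0 → ℝ) (g : ℝ → ℝ) (j : ℕ) (t : ℝ≥0) :
    g (S (π.pt j).toNNReal) * (S (π.stopped (j + 1) t) - S (π.stopped j t)) =
      g (S (π.stopped j t)) * (S (π.stopped (j + 1) t) - S (π.stopped j t)) := by
  rcases le_total (π.pt j) t with h | h
  · rw [show π.stopped j t = (π.pt j).toNNReal by rw [stopped, min_eq_left h]]
  · rw [π.stopped_of_le h, π.stopped_of_le (h.trans (π.mono (Nat.le_succ j))), sub_self, mul_zero,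
      mul_zero]

end TimePartition

section discreteLocalTime

variable {S : ℝ≥0 → ℝ} {π : TimePartition} {t : ℝ≥0} {K : ℕ}

theorem discreteLocalTime_eq_sum (hK : ∀ j ≥ K, π.stopped j t = t) (u : ℝ) :
    discreteLocalTime S π t u = ∑ j ∈ Finset.range K,
      stepKernel (S (π.stopped j t)) (S (π.stopped (j + 1) t)) u := by
  refine tsum_eq_sum fun j hj => ?_
  have hj : K ≤ j := by simpa using hj
  rw [hK j hj, hK (j + 1) (by omega), Set.uIoc, min_self, max_self, Set.Ioc_self,
    Set.indicator_empty]

theorem riemannSum_eq_sum (hK : ∀ j ≥ K, π.stopped j t = t) (g : ℝ → ℝ) :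
    riemannSum S π g t = ∑ j ∈ Finset.range K,
      g (S (π.stopped j t)) * (S (π.stopped (j + 1) t) - S (π.stopped j t)) := by
  simp only [riemannSum, π.mul_increment_eq]
  refine tsum_eq_sum fun j hj => ?_
  have hj : K ≤ j := by simpa using hj
  rw [hK j hj, hK (j + 1) (by omega), sub_self, mul_zero]

/-- The intervals omit their lower endpoint, so `u` may equal the minimum of the path. This kills
the boundary term of the Love-Young estimate at the left end. -/
theorem discreteLocalTime_eq_zero {u : ℝ} (hu : ∀ s ≤ t, u ≤ S s) :
    discreteLocalTime S π t u = 0 := by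
  obtain ⟨K, hK⟩ := π.exists_stopped_eq t
  rw [discreteLocalTime_eq_sum hK]
  refine Finset.sum_eq_zero fun j _ => Set.indicator_of_notMem (fun h => ?_) _
  have h1 := hu _ (π.stopped_le j t)
  have h2 := hu _ (π.stopped_le (j + 1) t)
  rcases Set.mem_uIoc.1 h with h | h <;> linarith [h.1]

/-- Discrete Tanaka-Meyer formula: `∫ L^π_t dg = ∫_{S(0)}^{S(t)} g - ∑_j g(S(t_j)) ΔS_j`. -/
theorem tendsto_stieltjesSum_discreteLocalTime {q a b B : ℝ} {g : ℝ → ℝ} (hq : 0 < q) (hB : 0 ≤ B)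
    (hgc : RightContinuous g) (hg : HasPVarBound q g (Set.Icc a b) B)
    (hS : ∀ s ≤ t, S s ∈ Set.Icc a b) :
    Tendsto (fun N => stieltjesSum (discreteLocalTime S π t) g (uniformGrid a b N) (N + 1)) atTop
      (𝓝 ((∫ x in S 0..S t, g x) - riemannSum S π g t)) := by
  obtain ⟨K, hK⟩ := π.exists_stopped_eq t
  have hmem : ∀ j, S (π.stopped j t) ∈ Set.Icc a b := fun j => hS _ (π.stopped_le j t)
  have hint := fun j k => intervalIntegrable_of_hasPVarBound hq hB hgc hg (hmem j) (hmem k)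
  have h1 : (∫ x in S 0..S t, g x) - riemannSum S π g t = ∑ j ∈ Finset.range K,
      ∫ x in S (π.stopped j t)..S (π.stopped (j + 1) t), (g x - g (S (π.stopped j t))) := by
    have h2 := intervalIntegral.sum_integral_adjacent_intervals (f := g) (μ := volume)
      (a := fun j => S (π.stopped j t)) (n := K) fun k _ => hint k (k + 1)
    simp only [hK K le_rfl, π.stopped_zero] at h2
    rw [← h2, riemannSum_eq_sum hK, ← Finset.sum_sub_distrib]
    refine Finset.sum_congr rfl fun j _ => ?_
    rw [intervalIntegral.integral_sub (hint _ _) intervalIntegrable_const,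
      intervalIntegral.integral_const, smul_eq_mul, mul_comm]
  rw [h1]
  have h3 : ∀ N, stieltjesSum (discreteLocalTime S π t) g (uniformGrid a b N) (N + 1) =
      ∑ j ∈ Finset.range K, stieltjesSum (stepKernel (S (π.stopped j t))
        (S (π.stopped (j + 1) t))) g (uniformGrid a b N) (N + 1) := fun N => by
    simp only [stieltjesSum, discreteLocalTime_eq_sum hK, Finset.sum_mul]
    rw [Finset.sum_comm]
  simp only [h3]
  exact tendsto_finsetSum _ fun j _ =>
    tendsto_stieltjesSum_stepKernel hq hB hgc hg (hmem j) (hmem (j + 1))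

end discreteLocalTime

theorem LocallyFinitePVariation.hasPVarBound {q : ℝ} {g : ℝ → ℝ} (hq : 0 < q)
    (hg : LocallyFinitePVariation q g) (a b : ℝ) :
    HasPVarBound q g (Set.Icc a b) (pVariationOn q g (Set.Icc a b)).toReal :=
  HasPVarBound.of_pVariationOn hq (hg a b)

theorem LocallyFinitePVariation.intervalIntegrable {q : ℝ} {g : ℝ → ℝ} (hq : 0 < q)
    (hgc : RightContinuous g) (hg : LocallyFinitePVariation q g) (c d : ℝ) :
    IntervalIntegrable g volume c d :=
  intervalIntegrable_of_hasPVarBound hq ENNReal.toReal_nonneg hgc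
    (hg.hasPVarBound hq (min c d) (max c d)) ⟨min_le_left _ _, le_max_left _ _⟩
    ⟨min_le_right _ _, le_max_right _ _⟩

theorem exists_forall_hasPVarBound_discreteLocalTime {p : ℝ} (hp : 0 < p) {π : ℕ → TimePartition}
    {S : ℝ≥0 → ℝ} (hS : S ∈ localTimePaths p π) (T : ℝ≥0) :
    ∃ V ≥ 0, ∀ t ≤ T, ∀ n, HasPVarBound p (discreteLocalTime S (π n) t) Set.univ V := by
  -- The hypothesis covers positive horizons only; `T + 1` includes the case `T = 0`.
  have h := hS.2 (T + 1) (by positivity)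
  refine ⟨(⨆ n : ℕ, ⨆ t ∈ Set.Icc 0 (T + 1),
    pVariationOn p (discreteLocalTime S (π n) t) Set.univ).toReal, ENNReal.toReal_nonneg,
    fun t ht n => ?_⟩
  have hle : pVariationOn p (discreteLocalTime S (π n) t) Set.univ ≤
      ⨆ n : ℕ, ⨆ t ∈ Set.Icc 0 (T + 1), pVariationOn p (discreteLocalTime S (π n) t) Set.univ :=
    le_iSup_of_le n (le_iSup₂_of_le t ⟨zero_le, ht.trans (by simp)⟩ le_rfl)
  exact (HasPVarBound.of_pVariationOn hp (hle.trans_lt h)).mono_bound hp.le ENNReal.toReal_nonneg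
    (ENNReal.toReal_mono h.ne hle)

theorem exists_forall_mem_Icc {S : ℝ≥0 → ℝ} (hS : Continuous S) (T : ℝ≥0) :
    ∃ a b, ∀ s ≤ T, S s ∈ Set.Icc a b := by
  have hc := (isCompact_Icc (a := (0 : ℝ≥0)) (b := T)).image hS
  obtain ⟨a, ha⟩ := hc.bddBelow
  obtain ⟨b, hb⟩ := hc.bddAbove
  exact ⟨a, b, fun s hs => ⟨ha ⟨s, ⟨zero_le, hs⟩, rfl⟩, hb ⟨s, ⟨zero_le, hs⟩, rfl⟩⟩⟩

/-! ### Passage to the limit along the partitions. -/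

section IsContinuousLocalTime

variable {p q : ℝ} {π : ℕ → TimePartition} {S : ℝ≥0 → ℝ} {L : ℝ≥0 → ℝ → ℝ} {g : ℝ → ℝ}
  {t : ℝ≥0} {a b A B J : ℝ}

theorem IsContinuousLocalTime.hasPVarBound (hL : IsContinuousLocalTime S π L) (hp : 0 ≤ p)
    (hV : ∀ n, HasPVarBound p (discreteLocalTime S (π n) t) Set.univ A) :
    HasPVarBound p (L t) Set.univ A :=
  HasPVarBound.of_tendsto hp hV fun x => (hL.2.1 t).tendsto_at x

theorem IsContinuousLocalTime.eq_zero (hL : IsContinuousLocalTime S π L)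
    (ha : ∀ s ≤ t, a ≤ S s) : L t a = 0 := by
  refine tendsto_nhds_unique ((hL.2.1 t).tendsto_at a) ?_
  simp only [discreteLocalTime_eq_zero ha, tendsto_const_nhds]

theorem IsContinuousLocalTime.continuous (hL : IsContinuousLocalTime S π L) (t : ℝ≥0) :
    Continuous (L t) :=
  hL.2.2.comp (Continuous.prodMk_right t)

theorem abs_limit_sub_le {φ ψ : ℝ → ℝ} {J J' ε : ℝ}
    (hφ : Tendsto (fun N => stieltjesSum φ g (uniformGrid a b N) (N + 1)) atTop (𝓝 J))
    (hψ : Tendsto (fun N => stieltjesSum ψ g (uniformGrid a b N) (N + 1)) atTop (𝓝 J'))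
    (h : ∀ N, |stieltjesSum (φ - ψ) g (uniformGrid a b N) (N + 1)| < ε) : |J - J'| ≤ ε := by
  refine le_of_tendsto' (hφ.sub hψ).abs fun N => ?_
  rw [← stieltjesSum_sub]
  exact (h N).le

/-- The grid sums of `L^{πⁿ}_t - L_t` are small uniformly in `N`, so the smallness survives the
limit `N → ∞`, where the discrete Tanaka-Meyer formula identifies the first term. -/
theorem IsContinuousLocalTime.hasPathwiseIntegral (hL : IsContinuousLocalTime S π L)
    (hp : 1 ≤ p) (hq : 1 ≤ q) (hpq : 1 < 1 / p + 1 / q) (hA : 0 ≤ A) (hB : 0 ≤ B)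
    (hV : ∀ n, HasPVarBound p (discreteLocalTime S (π n) t) Set.univ A)
    (hgc : RightContinuous g) (hg : HasPVarBound q g (Set.Icc a b) B)
    (hS : ∀ s ≤ t, S s ∈ Set.Icc a b)
    (hJ : Tendsto (fun N => stieltjesSum (L t) g (uniformGrid a b N) (N + 1)) atTop (𝓝 J)) :
    HasPathwiseIntegral S π g t ((∫ x in S 0..S t, g x) - J) := by
  have hab : a ≤ b := (hS t le_rfl).1.trans (hS t le_rfl).2
  rw [HasPathwiseIntegral, Metric.tendsto_nhds]
  intro ε hε
  obtain ⟨δ, hδ, hsmall⟩ := exists_abs_stieltjesSum_lt hp hq hpq (add_nonneg hA hA) hB hg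
    (half_pos hε)
  filter_upwards [Metric.tendstoUniformly_iff.1 (hL.2.1 t) δ hδ] with n hn
  have h1 := abs_limit_sub_le (tendsto_stieltjesSum_discreteLocalTime (π := π n) (by linarith) hB
    hgc hg hS) hJ (ε := ε / 2) fun N => hsmall _
      (((hV n).sub hp hA hA (hL.hasPVarBound (by linarith) hV)).mono_set (Set.subset_univ _))
      (fun x _ => by
        have := hn x
        rw [dist_comm, Real.dist_eq] at this
        exact this.le)
      _ _ (monotone_uniformGrid N hab) fun i hi => uniformGrid_mem_Icc N hab hi
  rw [Real.dist_eq, show riemannSum S (π n) g t - ((∫ x in S 0..S t, g x) - J) =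
    -((∫ x in S 0..S t, g x) - riemannSum S (π n) g t - J) by ring, abs_neg]
  linarith

theorem IsContinuousLocalTime.exists_hasYoungIntegral (hL : IsContinuousLocalTime S π L)
    (hp : 1 ≤ p) (hq : 1 ≤ q) (hpq : 1 < 1 / p + 1 / q) (hS : S ∈ localTimePaths p π)
    (hgc : RightContinuous g) (hg : LocallyFinitePVariation q g) (t : ℝ≥0) :
    ∃ J, HasPathwiseIntegral S π g t ((∫ x in S 0..S t, g x) - J) ∧ HasYoungIntegral (L t) g J := by
  obtain ⟨V, hV0, hV⟩ := exists_forall_hasPVarBound_discreteLocalTime (by linarith) hS t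
  obtain ⟨a₀, b₀, hab₀⟩ := exists_forall_mem_Icc hL.1.1 t
  have hex : ∀ a b : ℝ, ∃ J, a ≤ b → HasYoungIntegralOn (L t) g a b J ∧
      Tendsto (fun N => stieltjesSum (L t) g (uniformGrid a b N) (N + 1)) atTop (𝓝 J) := by
    intro a b
    by_cases hab : a ≤ b
    · obtain ⟨J, hJ⟩ := exists_hasYoungIntegralOn hp hq hpq hab hV0 ENNReal.toReal_nonneg
        (hL.continuous t).continuousOn ((hL.hasPVarBound (by linarith) (hV t le_rfl)).mono_set
          (Set.subset_univ _)) hgc (hg.hasPVarBound (by linarith) a b)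
      exact ⟨J, fun _ => hJ⟩
    · exact ⟨0, fun h => absurd h hab⟩
  choose J hJ using hex
  -- The Riemann sums do not involve `[a,b]`. Uniqueness of their limit forces `J a b` to be
  -- constant once `[a,b]` contains `[a₀,b₀]`, which settles the limit over the real line.
  have hpath : ∀ a ≤ a₀, ∀ b ≥ b₀,
      HasPathwiseIntegral S π g t ((∫ x in S 0..S t, g x) - J a b) := by
    intro a ha b hb
    have hS' : ∀ s ≤ t, S s ∈ Set.Icc a b := fun s hs =>
      ⟨ha.trans (hab₀ s hs).1, (hab₀ s hs).2.trans hb⟩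
    exact hL.hasPathwiseIntegral hp hq hpq hV0 ENNReal.toReal_nonneg (hV t le_rfl) hgc
      (hg.hasPVarBound (by linarith) a b) hS'
      (hJ a b ((hS' t le_rfl).1.trans (hS' t le_rfl).2)).2
  refine ⟨J a₀ b₀, hpath a₀ le_rfl b₀ le_rfl, J, fun a b hab => (hJ a b hab).1, ?_⟩
  refine tendsto_const_nhds.congr' ?_
  filter_upwards [(eventually_le_atBot a₀).prod_mk (eventually_ge_atTop b₀)] with x hx
  have := tendsto_nhds_unique (hpath a₀ le_rfl b₀ le_rfl) (hpath x.1 hx.1 x.2 hx.2)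
  linarith

theorem IsAbsolutelyContinuousWithDeriv.integral_eq_sub {f f' : ℝ → ℝ}
    (h : IsAbsolutelyContinuousWithDeriv f f') (c d : ℝ) : ∫ x in c..d, f' x = f d - f c := by
  rw [← (h.1 c d).integral_deriv_eq_sub]
  exact intervalIntegral.integral_congr_ae (h.2.mono fun x hx _ => hx.deriv.symm)

end IsContinuousLocalTime

theorem pVariationOn_mono_set (p : ℝ) (f : ℝ → ℝ) {s s' : Set ℝ} (h : s ⊆ s') :
    pVariationOn p f s ≤ pVariationOn p f s' :=
  iSup_le fun x => le_iSup (fun x : ℕ × {u : ℕ → ℝ // Monotone u ∧ ∀ i, u i ∈ s'} =>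
    (∑ k ∈ Finset.range x.1, edist (f (x.2.1 (k + 1))) (f (x.2.1 k)) ^ p) ^ (1 / p))
    ⟨x.1, x.2.1, x.2.2.1, fun i => h (x.2.2.2 i)⟩

theorem abs_le_pVarNorm {q : ℝ} (hq : 0 < q) {g : ℝ → ℝ} (hg : pVariationOn q g Set.univ < ∞)
    (x : ℝ) : |g x| ≤ pVarNorm q g := by
  refine le_trans (le_ciSup (f := fun x => |g x|) ⟨|g 0| + (pVariationOn q g Set.univ).toReal, ?_⟩ x)
    (le_max_right _ _)
  rintro _ ⟨y, rfl⟩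
  have h1 := (HasPVarBound.of_pVariationOn hq hg).abs_sub_le hq ENNReal.toReal_nonneg
    (Set.mem_univ y) (Set.mem_univ 0)
  have h2 := abs_sub_abs_le_abs_sub (g y) (g 0)
  change |g y| ≤ _
  linarith

/-! ### Continuity in time, operator bound and linearity. -/

section pathwiseIntegral

variable {p q : ℝ} {π : ℕ → TimePartition} {S : ℝ≥0 → ℝ} {L : ℝ≥0 → ℝ → ℝ} {g : ℝ → ℝ}
  {a b A B : ℝ}

theorem IsContinuousLocalTime.tendsto_stieltjesSum (hL : IsContinuousLocalTime S π L)
    (hp : 1 ≤ p) (hq : 1 ≤ q) (hpq : 1 < 1 / p + 1 / q) (hA : 0 ≤ A) {t : ℝ≥0}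
    (hV : ∀ n, HasPVarBound p (discreteLocalTime S (π n) t) Set.univ A)
    (hgc : RightContinuous g) (hg : LocallyFinitePVariation q g)
    (hS : ∀ s ≤ t, S s ∈ Set.Icc a b) {I : ℝ} (hI : HasPathwiseIntegral S π g t I) :
    Tendsto (fun N => stieltjesSum (L t) g (uniformGrid a b N) (N + 1)) atTop
      (𝓝 ((∫ x in S 0..S t, g x) - I)) := by
  have hgb := hg.hasPVarBound (by linarith) a b
  obtain ⟨J, -, hJ⟩ := exists_hasYoungIntegralOn hp hq hpq
    ((hS t le_rfl).1.trans (hS t le_rfl).2) hA ENNReal.toReal_nonneg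
    (hL.continuous t).continuousOn ((hL.hasPVarBound (by linarith) hV).mono_set
      (Set.subset_univ _)) hgc hgb
  have := tendsto_nhds_unique hI (hL.hasPathwiseIntegral hp hq hpq hA ENNReal.toReal_nonneg hV hgc
    hgb hS hJ)
  rwa [this, sub_sub_cancel]

theorem IsContinuousLocalTime.continuous_pathwiseIntegral (hL : IsContinuousLocalTime S π L)
    (hp : 1 ≤ p) (hq : 1 ≤ q) (hpq : 1 < 1 / p + 1 / q) (hS : S ∈ localTimePaths p π)
    (hgc : RightContinuous g) (hg : LocallyFinitePVariation q g) {T : ℝ≥0}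
    {I : Set.Icc (0 : ℝ≥0) T → ℝ}
    (hI : ∀ t : Set.Icc (0 : ℝ≥0) T, HasPathwiseIntegral S π g t (I t)) :
    Continuous I := by
  have hp0 : 0 ≤ p := by linarith
  have hq0 : 0 < q := by linarith
  obtain ⟨V, hV0, hV⟩ := exists_forall_hasPVarBound_discreteLocalTime (by linarith) hS T
  obtain ⟨a, b, hab⟩ := exists_forall_mem_Icc hL.1.1 T
  have hle : a ≤ b := (hab T le_rfl).1.trans (hab T le_rfl).2
  have hlim : ∀ t : Set.Icc (0 : ℝ≥0) T,
      Tendsto (fun N => stieltjesSum (L t) g (uniformGrid a b N) (N + 1)) atTop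
        (𝓝 ((∫ x in S 0..S t, g x) - I t)) := fun t =>
    hL.tendsto_stieltjesSum hp hq hpq hV0 (hV t t.2.2) hgc hg
      (fun s hs => hab s (hs.trans t.2.2)) (hI t)
  have hJ : Continuous fun t : Set.Icc (0 : ℝ≥0) T => (∫ x in S 0..S t, g x) - I t := by
    rw [continuous_iff_continuousAt]
    intro t
    rw [ContinuousAt, Metric.tendsto_nhds]
    intro ε hε
    obtain ⟨δ, hδ, hsmall⟩ := exists_abs_stieltjesSum_lt hp hq hpq (add_nonneg hV0 hV0)
      ENNReal.toReal_nonneg (hg.hasPVarBound hq0 a b) (half_pos hε)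
    -- Joint continuity of `L` and compactness of `[a,b]` make `L s` uniformly close to `L t` on
    -- `[a,b]` for `s` near `t`.
    obtain ⟨v, hv, hvδ⟩ := IsCompact.mem_uniformity_of_prod (f := L) (s := Set.univ)
      (q := (t : ℝ≥0)) (isCompact_Icc (a := a) (b := b)) hL.2.2.continuousOn (Set.mem_univ _)
      (Metric.dist_mem_uniformity hδ)
    rw [nhdsWithin_univ] at hv
    filter_upwards [continuous_subtype_val.continuousAt hv] with s hs
    rw [Real.dist_eq]
    refine (abs_limit_sub_le (hlim s) (hlim t) (ε := ε / 2) fun N => hsmall _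
      (((hL.hasPVarBound hp0 (hV s s.2.2)).sub hp hV0 hV0
        (hL.hasPVarBound hp0 (hV t t.2.2))).mono_set (Set.subset_univ _))
      (fun x hx => le_of_lt (hvδ s hs x hx)) _ _ (monotone_uniformGrid N hle)
      fun i hi => uniformGrid_mem_Icc N hle hi).trans_lt (half_lt_self hε)
  have hF : Continuous fun t : Set.Icc (0 : ℝ≥0) T => ∫ x in S 0..S t, g x :=
    (intervalIntegral.continuous_primitive (hg.intervalIntegrable hq0 hgc) (S 0)).comp
      (hL.1.1.comp continuous_subtype_val)
  exact (hF.sub hJ).congr fun t => sub_sub_cancel _ _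

theorem IsContinuousLocalTime.exists_abs_pathwiseIntegral_le (hL : IsContinuousLocalTime S π L)
    (hp : 1 ≤ p) (hq : 1 ≤ q) (hpq : 1 < 1 / p + 1 / q) (hS : S ∈ localTimePaths p π) (T : ℝ≥0) :
    ∃ C ≥ 0, ∀ g : ℝ → ℝ, RightContinuous g → pVariationOn q g Set.univ < ∞ → ∀ t ≤ T, ∀ I : ℝ,
      HasPathwiseIntegral S π g t I → |I| ≤ C * pVarNorm q g := by
  have hq0 : 0 < q := by linarith
  obtain ⟨V, hV0, hV⟩ := exists_forall_hasPVarBound_discreteLocalTime (by linarith) hS T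
  obtain ⟨a, b, hab⟩ := exists_forall_mem_Icc hL.1.1 T
  have hle : a ≤ b := (hab T le_rfl).1.trans (hab T le_rfl).2
  have hC := youngConst_nonneg p q
  -- `b - a` bounds the contribution of the integral of `g`, and `youngConst p q * V` that of the
  -- local time. Since `[a,b]` and `V` are chosen for the horizon `T`, the constant serves all `t ≤
  -- T`.
  refine ⟨(b - a) + youngConst p q * V, by have := sub_nonneg.2 hle; positivity,
    fun g hgc hgv t ht I hI => ?_⟩
  have hSt : ∀ s ≤ t, S s ∈ Set.Icc a b := fun s hs => hab s (hs.trans ht)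
  have hg : LocallyFinitePVariation q g := fun a b =>
    (pVariationOn_mono_set q g (Set.subset_univ _)).trans_lt hgv
  have hlim := hL.tendsto_stieltjesSum hp hq hpq hV0 (hV t ht) hgc hg hSt hI
  have hN : 0 ≤ pVarNorm q g := (abs_nonneg _).trans (abs_le_pVarNorm hq0 hgv 0)
  have h1 : |(∫ x in S 0..S t, g x) - I| ≤ youngConst p q * V * pVarNorm q g := by
    refine le_of_tendsto' hlim.abs fun N => ?_
    have h := abs_stieltjesSum_sub_le (by linarith) hq0 hpq hV0 ENNReal.toReal_nonneg
      (hL.hasPVarBound (by linarith) (hV t ht)) (HasPVarBound.of_pVariationOn hq0 hgv) (N + 1)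
      (uniformGrid a b N) (monotone_uniformGrid N hle) fun _ _ => Set.mem_univ _
    rw [uniformGrid_zero, hL.eq_zero fun s hs => (hSt s hs).1, zero_mul, sub_zero] at h
    refine h.trans ?_
    gcongr
    exact le_max_left _ _
  have h2 : |∫ x in S 0..S t, g x| ≤ pVarNorm q g * (b - a) := by
    refine (intervalIntegral.norm_integral_le_of_norm_le_const (f := g) (C := pVarNorm q g)
      fun x _ => abs_le_pVarNorm hq0 hgv x).trans ?_
    gcongr
    have h0 := hSt 0 zero_le
    have h1 := hSt t le_rfl
    rw [abs_le]
    constructor <;> linarith [h0.1, h0.2, h1.1, h1.2]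
  have h3 := abs_sub_abs_le_abs_sub I (∫ x in S 0..S t, g x)
  rw [abs_sub_comm] at h3
  nlinarith

theorem HasPathwiseIntegral.add {g h : ℝ → ℝ} {t : ℝ≥0} {I I' : ℝ}
    (hg : HasPathwiseIntegral S π g t I) (hh : HasPathwiseIntegral S π h t I') :
    HasPathwiseIntegral S π (g + h) t (I + I') := by
  refine (Tendsto.add hg hh).congr fun n => ?_
  obtain ⟨K, hK⟩ := (π n).exists_stopped_eq t
  simp only [riemannSum_eq_sum hK, ← Finset.sum_add_distrib, Pi.add_apply, add_mul]

theorem HasPathwiseIntegral.const_smul {g : ℝ → ℝ} {t : ℝ≥0} {I : ℝ} (c : ℝ)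
    (hg : HasPathwiseIntegral S π g t I) : HasPathwiseIntegral S π (c • g) t (c * I) := by
  refine (Tendsto.const_mul c hg).congr fun n => ?_
  obtain ⟨K, hK⟩ := (π n).exists_stopped_eq t
  simp only [riemannSum_eq_sum hK, Finset.mul_sum, Pi.smul_apply, smul_eq_mul, mul_assoc]

end pathwiseIntegral

theorem theorem2p5 (p q : ℝ) (hp : 1 ≤ p) (hq : 1 ≤ q) (hpq : 1 < 1 / p + 1 / q)
    (π : ℕ → TimePartition) (S : ℝ≥0 → ℝ) (hS : S ∈ localTimePaths p π)
    (L : ℝ≥0 → ℝ → ℝ) (hL : IsContinuousLocalTime S π L) :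
    (∀ f f' : ℝ → ℝ, IsAbsolutelyContinuousWithDeriv f f' → RightContinuous f' →
      LocallyFinitePVariation q f' → ∀ t : ℝ≥0, ∃ I J : ℝ,
        HasPathwiseIntegral S π f' t I ∧ HasYoungIntegral (L t) f' J ∧
        f (S t) = f (S 0) + I + J) ∧
    (∀ g : ℝ → ℝ, RightContinuous g → LocallyFinitePVariation q g →
      ∀ t : ℝ≥0, ∃ I : ℝ, HasPathwiseIntegral S π g t I) ∧
    (∀ T : ℝ≥0, 0 < T →
      ∃ A : pVarSpace q hq →ₗ[ℝ] C(Set.Icc (0 : ℝ≥0) T, ℝ),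
        (∀ (g : pVarSpace q hq) (t : Set.Icc (0 : ℝ≥0) T), HasPathwiseIntegral S π g t (A g t)) ∧
        ∃ C : ℝ, ∀ g : pVarSpace q hq, ‖A g‖ ≤ C * pVarNorm q g) := by
  have hex : ∀ g : ℝ → ℝ, RightContinuous g → LocallyFinitePVariation q g →
      ∀ t : ℝ≥0, ∃ I : ℝ, HasPathwiseIntegral S π g t I := fun g hgc hg t =>
    let ⟨_, hJ, _⟩ := hL.exists_hasYoungIntegral hp hq hpq hS hgc hg t
    ⟨_, hJ⟩
  refine ⟨fun f f' hf hgc hg t => ?_, hex, fun T _ => ?_⟩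
  · obtain ⟨J, hI, hJ⟩ := hL.exists_hasYoungIntegral hp hq hpq hS hgc hg t
    refine ⟨_, J, hI, hJ, ?_⟩
    rw [hf.integral_eq_sub]
    ring
  · have hloc : ∀ g : pVarSpace q hq, LocallyFinitePVariation q g := fun g a b =>
      (pVariationOn_mono_set q g (Set.subset_univ _)).trans_lt g.2.2
    choose I hI using fun (g : pVarSpace q hq) (t : Set.Icc (0 : ℝ≥0) T) =>
      hex g g.2.1 (hloc g) t
    obtain ⟨C, hC0, hC⟩ := hL.exists_abs_pathwiseIntegral_le hp hq hpq hS T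
    let A : pVarSpace q hq →ₗ[ℝ] C(Set.Icc (0 : ℝ≥0) T, ℝ) :=
      { toFun := fun g =>
          ⟨I g, hL.continuous_pathwiseIntegral hp hq hpq hS g.2.1 (hloc g) (hI g)⟩
        -- The chosen values are limits, hence unique, so linearity passes from the Riemann sums to
        -- `I`.
        map_add' := fun g h => ContinuousMap.ext fun t =>
          tendsto_nhds_unique (hI (g + h) t) ((hI g t).add (hI h t))
        map_smul' := fun c g => ContinuousMap.ext fun t =>
          tendsto_nhds_unique (hI (c • g) t) ((hI g t).const_smul c) }
    refine ⟨A, hI, C, fun g => ?_⟩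
    have hN : 0 ≤ pVarNorm q g :=
      (abs_nonneg _).trans (abs_le_pVarNorm (by linarith) g.2.2 0)
    rw [ContinuousMap.norm_le _ (mul_nonneg hC0 hN)]
    exact fun t => hC g g.2.1 g.2.2 t t.2.2 _ (hI g t)
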